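/- Let $d \ge 1$ be an integer, let $G$ be a nonempty finite simple $d$-regular graph containing no triangle, and let $H$ be a finite undirected graph, without multiple edges, in which loops are allowed. Write $\hom(G,H)$ for the number of graph homomorphisms from $G$ to $H$, that is, of maps $\phi\colon V(G)\to V(H)$ such that $\phi(u)\phi(v)$ is an edge (possibly a loop) of $H$ whenever $uv$ is an edge of $G$, and $K_{d,d}$ for the complete bipartite graph with $d$ vertices in each part. Then \[ \hom(G,H)^{1/|V(G)|} \le \hom(K_{d,d},H)^{1/(2d)}. \] -/

import Mathlib

/-- A graph in which loops are allowed (but no multiple edges): a symmetric relation on the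
vertex set. The vertex `x` carries a loop when `Adj x x` holds. -/
structure LoopGraph (W : Type*) where
  Adj : W → W → Prop
  symm : ∀ x y : W, Adj x y → Adj y x

/-- A graph homomorphism from the simple graph `G` to the graph `H` allowing loops: a map of
vertices that sends every edge of `G` to an edge (possibly a loop) of `H`. -/
def LoopGraph.IsHom {V W : Type*} (G : SimpleGraph V) (H : LoopGraph W) (φ : V → W) : Prop :=
  ∀ u v : V, G.Adj u v → H.Adj (φ u) (φ v)

/-- `homCount G H` is `hom(G, H)`, the number of graph homomorphisms from `G` to `H`. -/
noncomputable def homCount {V W : Type*} (G : SimpleGraph V) (H : LoopGraph W) : ℕ :=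
  Nat.card {φ : V → W // LoopGraph.IsHom G H φ}

/-! The count is generalised by giving every vertex v of G its own weight function λ_v on H. For
triangle-free G the weighted count is at most the product, over edges uv, of (weighted count of
K_{d_v,d_u}, with λ_u on the d_v vertices and λ_v on the d_u vertices)^{1/(d_u d_v)}, times the
total weight at each isolated vertex (`weightedHomCount_le_prod_vertexFactor`). Trivial weights and
equal degrees give the theorem.

The weights make induction possible: pin a vertex w of maximum degree to a colour x, and its edges
become weights on its neighbours. As G has no triangle, each affected edge not at w has exactly one
end in N(w). Hölder over N(w), then over the other neighbours of each v in N(w), reduces the sum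
over x to one inequality about bicliques, `sum_mul_bicliqueSum_rpow_le`, itself two applications of
Hölder. -/

/-! ### Hölder's inequality on finite weighted spaces. -/

open scoped NNReal in
/-- Hölder's inequality for finitely many functions on a finite type. -/
theorem NNReal.sum_prod_rpow_le {ι κ : Type*} [Fintype ι] (s : Finset κ) (F : κ → ι → ℝ≥0)
    (p : κ → ℝ) (hp : ∑ j ∈ s, p j = 1) (hp0 : ∀ j ∈ s, 0 ≤ p j) :
    ∑ i, ∏ j ∈ s, F j i ^ p j ≤ ∏ j ∈ s, (∑ i, F j i) ^ p j := by
  let _ : MeasurableSpace ι := ⊤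
  have : DiscreteMeasurableSpace ι := ⟨fun _ => trivial⟩
  have h := ENNReal.lintegral_prod_norm_pow_le (μ := MeasureTheory.Measure.count) s
    (f := fun j i => (F j i : ENNReal)) (fun j _ => (measurable_of_finite _).aemeasurable) hp hp0
  simp only [MeasureTheory.lintegral_count, tsum_fintype] at h
  have h1 : ∀ i, ∏ j ∈ s, (F j i : ENNReal) ^ p j = ((∏ j ∈ s, F j i ^ p j : ℝ≥0) : ENNReal) := by
    intro i
    rw [ENNReal.ofNNReal_finsetProd]
    exact Finset.prod_congr rfl fun j hj => (ENNReal.coe_rpow_of_nonneg _ (hp0 j hj)).symm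
  have h2 : ∏ j ∈ s, (∑ i, (F j i : ENNReal)) ^ p j
      = ((∏ j ∈ s, (∑ i, F j i) ^ p j : ℝ≥0) : ENNReal) := by
    rw [ENNReal.ofNNReal_finsetProd]
    refine Finset.prod_congr rfl fun j hj => ?_
    rw [ENNReal.coe_rpow_of_nonneg _ (hp0 j hj), ENNReal.ofNNReal_finsetSum]
  rw [h2] at h
  simp only [h1] at h
  rw [← ENNReal.ofNNReal_finsetSum] at h
  exact_mod_cast h

open scoped NNReal in
theorem NNReal.prod_rpow_eq_rpow_sum {κ : Type*} (s : Finset κ) (w : ℝ≥0)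
    (p : κ → ℝ) (hp0 : ∀ j ∈ s, 0 ≤ p j) : ∏ j ∈ s, w ^ p j = w ^ ∑ j ∈ s, p j := by
  apply NNReal.coe_injective
  push_cast
  exact (Real.rpow_sum_of_nonneg w.2 hp0).symm

open scoped NNReal in
/-- Hölder's inequality for finitely many functions on a finite weighted space. -/
theorem NNReal.sum_mul_prod_rpow_le {ι κ : Type*} [Fintype ι] (w : ι → ℝ≥0) (s : Finset κ)
    (F : κ → ι → ℝ≥0) (p : κ → ℝ) (hp : ∑ j ∈ s, p j = 1) (hp0 : ∀ j ∈ s, 0 ≤ p j) :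
    ∑ i, w i * ∏ j ∈ s, F j i ^ p j ≤ ∏ j ∈ s, (∑ i, w i * F j i) ^ p j := by
  refine le_trans (le_of_eq ?_) (NNReal.sum_prod_rpow_le s (fun j i => w i * F j i) p hp hp0)
  refine Finset.sum_congr rfl fun i _ => ?_
  simp only [NNReal.mul_rpow, Finset.prod_mul_distrib]
  rw [NNReal.prod_rpow_eq_rpow_sum s _ p hp0, hp, NNReal.rpow_one]

open scoped NNReal in
theorem NNReal.sum_mul_rpow_mul_rpow_le {ι : Type*} [Fintype ι] (w f g : ι → ℝ≥0) {θ : ℝ}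
    (h0 : 0 ≤ θ) (h1 : θ ≤ 1) :
    ∑ i, w i * (f i ^ θ * g i ^ (1 - θ)) ≤
      (∑ i, w i * f i) ^ θ * (∑ i, w i * g i) ^ (1 - θ) := by
  have h := NNReal.sum_mul_prod_rpow_le w (Finset.univ : Finset (Fin 2)) ![f, g] ![θ, 1 - θ]
    (by simp) (by intro j _; fin_cases j <;> simp [h0, h1])
  simpa using h

/-! ### Weighted biclique counts. -/

open scoped NNReal in
/-- The weighted number of homomorphisms of `K_{s,t}` to the weighted graph `f`, with vertex
weights `α` on the part of size `s` and `β` on the part of size `t`. -/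
noncomputable def bicliqueSum {W : Type*} [Fintype W] (f : W → W → ℝ≥0) (s t : ℕ)
    (α β : W → ℝ≥0) : ℝ≥0 :=
  ∑ X : Fin s → W, (∏ i, α (X i)) * (∑ y, β y * ∏ i, f (X i) y) ^ t

open scoped NNReal in
theorem sum_pow_eq_sum_prod {W : Type*} [Fintype W] (g : W → ℝ≥0) (t : ℕ) :
    (∑ y, g y) ^ t = ∑ Y : Fin t → W, ∏ j, g (Y j) := by
  classical
  rw [Finset.sum_pow', Fintype.piFinset_univ]

open scoped NNReal in
theorem bicliqueSum_eq {W : Type*} [Fintype W] (f : W → W → ℝ≥0) (s t : ℕ) (α β : W → ℝ≥0) :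
    bicliqueSum f s t α β = ∑ X : Fin s → W, ∑ Y : Fin t → W,
      (∏ i, α (X i)) * (∏ j, β (Y j)) * ∏ i, ∏ j, f (X i) (Y j) := by
  unfold bicliqueSum
  refine Finset.sum_congr rfl fun X _ => ?_
  rw [sum_pow_eq_sum_prod, Finset.mul_sum]
  refine Finset.sum_congr rfl fun Y _ => ?_
  rw [Finset.prod_mul_distrib, mul_assoc, Finset.prod_comm]

open scoped NNReal in
theorem bicliqueSum_comm {W : Type*} [Fintype W] {f : W → W → ℝ≥0} (hf : ∀ x y, f x y = f y x)
    (s t : ℕ) (α β : W → ℝ≥0) : bicliqueSum f s t α β = bicliqueSum f t s β α := by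
  rw [bicliqueSum_eq, bicliqueSum_eq, Finset.sum_comm]
  refine Finset.sum_congr rfl fun Y _ => Finset.sum_congr rfl fun X _ => ?_
  rw [Finset.prod_comm, mul_comm (∏ i, α (X i))]
  simp only [hf]

/-! ### The local inequality at a pinned vertex. -/

open scoped NNReal in
/-- The one-vertex step of the homomorphism inequality: attaching a vertex of degree `c` to the
part of size `b + 1` of a complete bipartite graph. -/
theorem sum_mul_bicliqueSum_rpow_le {W : Type*} [Fintype W] {f : W → W → ℝ≥0}
    (hf : ∀ x y, f x y = f y x) {a b c : ℕ} (ha : 1 ≤ a) (hac : a ≤ c) (ω α β : W → ℝ≥0) :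
    ∑ x, ω x * bicliqueSum f b a α (fun y => β y * f x y) ^ ((c : ℝ) / a) ≤
      bicliqueSum f (b + 1) c ω β ^ (1 / ((b + 1 : ℕ) : ℝ)) *
        bicliqueSum f (b + 1) a α β ^ ((b * c : ℝ) / (a * (b + 1 : ℕ))) := by
  have ha' : (0 : ℝ) < a := by exact_mod_cast ha
  have hc' : (0 : ℝ) < c := by exact_mod_cast (ha.trans hac)
  have hac' : (a : ℝ) ≤ c := by exact_mod_cast hac
  have hb' : (0 : ℝ) < ((b + 1 : ℕ) : ℝ) := by positivity
  set A : W → ℝ≥0 := fun x => bicliqueSum f b a α (fun y => β y * f x y) with hA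
  set p : ℝ := (c : ℝ) / a with hp
  have hp1 : 1 ≤ p := by rw [hp, le_div_iff₀ ha']; linarith
  set S : ℝ≥0 := ∑ x, ω x * A x ^ p with hS
  -- Splitting off one factor of `A` makes S linear in `A`, so it becomes a K_{b+1,a} count in which
  -- one vertex carries weight `k` and b carry `α`.
  set k : W → ℝ≥0 := fun x => ω x * A x ^ (p - 1) with hk
  set Φ : (Fin a → W) → ℝ≥0 := fun Y => ∑ x, α x * ∏ j, f (Y j) x with hΦ
  set Ψ : (Fin a → W) → ℝ≥0 := fun Y => ∑ x, k x * ∏ j, f (Y j) x with hΨ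
  have hAeq : ∀ x, A x = ∑ Y : Fin a → W, (∏ j, β (Y j)) * (∏ j, f (Y j) x) * Φ Y ^ b := by
    intro x
    simp only [hA]
    rw [bicliqueSum_comm hf]
    unfold bicliqueSum
    refine Finset.sum_congr rfl fun Y _ => ?_
    rw [Finset.prod_mul_distrib]
    simp only [hf x, hΦ]
  have hpow : ∀ z : ℝ≥0, z ^ p = z ^ (p - 1) * z := by
    intro z
    conv_rhs => rw [← NNReal.rpow_one z, ← NNReal.rpow_mul, one_mul]
    rw [← NNReal.rpow_add_of_nonneg _ (by linarith) zero_le_one]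
    simp
  have hS1 : S = ∑ Y : Fin a → W, (∏ j, β (Y j)) * (Φ Y ^ b * Ψ Y) := by
    have : ∀ x, ω x * A x ^ p = ∑ Y : Fin a → W,
        k x * ((∏ j, β (Y j)) * (∏ j, f (Y j) x) * Φ Y ^ b) := by
      intro x
      rw [hpow, ← mul_assoc, ← Finset.mul_sum, ← hAeq]
    rw [hS]
    simp only [this]
    rw [Finset.sum_comm]
    refine Finset.sum_congr rfl fun Y _ => ?_
    simp only [hΨ, Finset.mul_sum]
    exact Finset.sum_congr rfl fun x _ => by ring
  have hS2 : S ≤ bicliqueSum f (b + 1) a k β ^ (1 / ((b + 1 : ℕ) : ℝ)) *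
      bicliqueSum f (b + 1) a α β ^ (1 - 1 / ((b + 1 : ℕ) : ℝ)) := by
    have h := NNReal.sum_mul_rpow_mul_rpow_le (fun Y : Fin a → W => ∏ j, β (Y j))
      (fun Y => Ψ Y ^ (b + 1)) (fun Y => Φ Y ^ (b + 1)) (θ := 1 / ((b + 1 : ℕ) : ℝ))
      (by positivity) (by
        rw [div_le_one hb']
        push_cast
        linarith [(Nat.cast_nonneg b : (0 : ℝ) ≤ b)])
    rw [bicliqueSum_comm hf _ _ k, bicliqueSum_comm hf _ _ α]
    refine le_trans (le_of_eq ?_) h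
    rw [hS1]
    refine Finset.sum_congr rfl fun Y _ => ?_
    congr 1
    rw [mul_comm]
    congr 1
    · rw [← NNReal.rpow_natCast, ← NNReal.rpow_mul, mul_one_div_cancel hb'.ne', NNReal.rpow_one]
    · rw [← NNReal.rpow_natCast, ← NNReal.rpow_natCast, ← NNReal.rpow_mul]
      congr 1
      field_simp
      push_cast
      ring
  have hθ0 : 0 ≤ (a : ℝ) / c := by positivity
  have hθ1 : (a : ℝ) / c ≤ 1 := by rw [div_le_one hc']; exact hac'
  -- Second Hölder, with exponent a/c ≤ 1; since p(1 - a/c) = p - 1, the factors of `A` reassemble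
  -- into S itself.
  have hk2 : bicliqueSum f (b + 1) a k β ≤
      bicliqueSum f (b + 1) c ω β ^ ((a : ℝ) / c) * (S ^ (b + 1)) ^ (1 - (a : ℝ) / c) := by
    have h := NNReal.sum_mul_rpow_mul_rpow_le (fun X : Fin (b + 1) → W => ∏ i, ω (X i))
      (fun X => (∑ y, β y * ∏ i, f (X i) y) ^ c) (fun X => ∏ i, A (X i) ^ p)
      hθ0 hθ1
    have e : ∑ X : Fin (b + 1) → W, (∏ i, ω (X i)) * ∏ i, A (X i) ^ p = S ^ (b + 1) := by
      rw [hS, sum_pow_eq_sum_prod]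
      exact Finset.sum_congr rfl fun X _ => Finset.prod_mul_distrib.symm
    rw [e] at h
    refine le_trans (le_of_eq ?_) h
    unfold bicliqueSum
    refine Finset.sum_congr rfl fun X _ => ?_
    simp only [hk, Finset.prod_mul_distrib]
    rw [mul_assoc, mul_comm (∏ i, A (X i) ^ (p - 1))]
    congr 2
    · rw [← NNReal.rpow_natCast, ← NNReal.rpow_natCast, ← NNReal.rpow_mul]
      congr 1
      field_simp
    · rw [← NNReal.finsetProd_rpow]
      refine Finset.prod_congr rfl fun i _ => ?_
      rw [← NNReal.rpow_mul]
      congr 1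
      rw [hp]
      field_simp
  set P := bicliqueSum f (b + 1) c ω β with hP
  set Q := bicliqueSum f (b + 1) a α β with hQ
  -- S now bounds itself; a power of S is cancelled, so it must be nonzero.
  by_cases hS0 : S = 0
  · rw [hS0]; exact zero_le
  have key : S ≤ (P ^ ((a : ℝ) / c * (1 / ((b + 1 : ℕ) : ℝ))) * Q ^ (1 - 1 / ((b + 1 : ℕ) : ℝ))) *
      S ^ (1 - (a : ℝ) / c) := by
    refine hS2.trans ?_
    refine (mul_le_mul_left (NNReal.rpow_le_rpow hk2 (by positivity)) _).trans (le_of_eq ?_)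
    rw [NNReal.mul_rpow, ← NNReal.rpow_mul, ← NNReal.rpow_mul, ← NNReal.rpow_natCast,
      ← NNReal.rpow_mul]
    have : ((b + 1 : ℕ) : ℝ) * ((1 - (a : ℝ) / c) * (1 / ((b + 1 : ℕ) : ℝ))) = 1 - (a : ℝ) / c := by
      field_simp
    simp only [mul_assoc] at this ⊢
    rw [this]
    ring
  have hSpos : 0 < S ^ (1 - (a : ℝ) / c) := NNReal.rpow_pos (pos_iff_ne_zero.mpr hS0)
  have hSS : S = S ^ ((a : ℝ) / c) * S ^ (1 - (a : ℝ) / c) := by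
    rw [← NNReal.rpow_add hS0]; simp
  have key2 : S ^ ((a : ℝ) / c) ≤
      P ^ ((a : ℝ) / c * (1 / ((b + 1 : ℕ) : ℝ))) * Q ^ (1 - 1 / ((b + 1 : ℕ) : ℝ)) := by
    refine le_of_mul_le_mul_right ?_ hSpos
    rw [← hSS]
    exact key
  have key3 := NNReal.rpow_le_rpow key2 (z := p) (by linarith)
  rw [NNReal.mul_rpow, ← NNReal.rpow_mul, ← NNReal.rpow_mul, ← NNReal.rpow_mul] at key3
  have e1 : (a : ℝ) / c * p = 1 := by rw [hp]; field_simp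
  have e2 : (a : ℝ) / c * (1 / ((b + 1 : ℕ) : ℝ)) * p = 1 / ((b + 1 : ℕ) : ℝ) := by
    rw [hp]; field_simp
  have e3 : (1 - 1 / ((b + 1 : ℕ) : ℝ)) * p = (b * c : ℝ) / (a * (b + 1 : ℕ)) := by
    rw [hp]; field_simp; push_cast; ring
  rwa [e1, e2, e3, NNReal.rpow_one] at key3

-- The contribution of one neighbour v of w, with s = N(v) \ {w} and c = deg w: Hölder with equal
-- exponents 1/|s| separates the edges at v. The squares occur because each edge is counted in both
-- orders.
open scoped NNReal in
theorem sum_mul_prod_bicliqueSum_pow_le {W ι : Type*} [Fintype W] {f : W → W → ℝ≥0}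
    (hf : ∀ x y, f x y = f y x) (s : Finset ι) (a : ι → ℕ) {c : ℕ} (hc : 1 ≤ c)
    (ha : ∀ u ∈ s, 1 ≤ a u) (hac : ∀ u ∈ s, a u ≤ c) (ω β : W → ℝ≥0) (α : ι → W → ℝ≥0) :
    ∑ x, ω x * ((if s.card = 0 then ∑ y, β y * f x y else 1) *
        ∏ u ∈ s, (bicliqueSum f s.card (a u) (α u) (fun y => β y * f x y) ^
          (1 / (2 * (a u : ℝ) * (s.card : ℝ)))) ^ 2) ^ c ≤
      ((bicliqueSum f (s.card + 1) c ω β ^ (1 / (2 * (c : ℝ) * ((s.card + 1 : ℕ) : ℝ)))) ^ 2 *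
        ∏ u ∈ s, (bicliqueSum f (s.card + 1) (a u) (α u) β ^
          (1 / (2 * (a u : ℝ) * ((s.card + 1 : ℕ) : ℝ)))) ^ 2) ^ c := by
  have hc' : (0 : ℝ) < c := by exact_mod_cast hc
  rcases Nat.eq_zero_or_pos s.card with h0 | hpos
  · have hs : s = ∅ := Finset.card_eq_zero.mp h0
    subst hs
    -- Here v is a leaf: with b = 0 the last exponent vanishes, so a = 1 and α = ω are arbitrary
    -- choices.
    have h := sum_mul_bicliqueSum_rpow_le hf (b := 0) le_rfl hc ω ω β
    simp only [bicliqueSum, Finset.univ_unique, Finset.sum_singleton, Finset.univ_eq_empty,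
      Finset.prod_empty, one_mul, mul_one, pow_one] at h
    simp only [Finset.card_empty, if_true, Finset.prod_empty, mul_one]
    refine le_trans (le_of_eq ?_) (h.trans (le_of_eq ?_))
    · simp
    · simp only [bicliqueSum, ← pow_mul]
      rw [← NNReal.rpow_natCast (_ ^ (_ : ℝ)), ← NNReal.rpow_mul]
      simp only [Nat.cast_zero, zero_mul, zero_div, NNReal.rpow_zero, mul_one]
      congr 1
      push_cast
      field_simp
  · set b := s.card with hb
    have hb' : (0 : ℝ) < b := by exact_mod_cast hpos
    have hb0 : b ≠ 0 := hpos.ne'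
    simp only [hb0, if_false, one_mul]
    have hL : ∀ x, (∏ u ∈ s, (bicliqueSum f b (a u) (α u) (fun y => β y * f x y) ^
          (1 / (2 * (a u : ℝ) * (b : ℝ)))) ^ 2) ^ c =
        ∏ u ∈ s, (bicliqueSum f b (a u) (α u) (fun y => β y * f x y) ^ ((c : ℝ) / a u)) ^
          (1 / (b : ℝ)) := by
      intro x
      rw [← Finset.prod_pow]
      refine Finset.prod_congr rfl fun u hu => ?_
      have hau : (0 : ℝ) < a u := by exact_mod_cast ha u hu
      rw [← pow_mul, ← NNReal.rpow_natCast (_ ^ (_ : ℝ)), ← NNReal.rpow_mul, ← NNReal.rpow_mul]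
      congr 1
      push_cast
      field_simp
    simp only [hL]
    have hsum : ∑ _u ∈ s, 1 / (b : ℝ) = 1 := by
      rw [Finset.sum_const, ← hb, nsmul_eq_mul]
      field_simp
    refine (NNReal.sum_mul_prod_rpow_le ω s (fun u x =>
      bicliqueSum f b (a u) (α u) (fun y => β y * f x y) ^ ((c : ℝ) / a u)) (fun _ => 1 / (b : ℝ))
      hsum (fun _ _ => by positivity)).trans ?_
    refine (Finset.prod_le_prod' fun u hu => NNReal.rpow_le_rpow
      (sum_mul_bicliqueSum_rpow_le hf (ha u hu) (hac u hu) ω (α u) β)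
      (by positivity)).trans (le_of_eq ?_)
    simp only [NNReal.mul_rpow]
    rw [Finset.prod_mul_distrib, Finset.prod_const, ← hb, mul_pow, ← Finset.prod_pow]
    congr 1
    · rw [← pow_mul, ← NNReal.rpow_natCast (_ ^ (_ : ℝ)), ← NNReal.rpow_natCast (_ ^ (_ : ℝ)),
        ← NNReal.rpow_mul, ← NNReal.rpow_mul, ← NNReal.rpow_mul]
      congr 1
      push_cast
      field_simp
    · refine Finset.prod_congr rfl fun u hu => ?_
      have hau : (0 : ℝ) < a u := by exact_mod_cast ha u hu
      rw [← pow_mul, ← NNReal.rpow_natCast (_ ^ (_ : ℝ)), ← NNReal.rpow_mul, ← NNReal.rpow_mul]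
      congr 1
      push_cast
      field_simp

/-! ### Weighted homomorphism counts and pinning a vertex. -/

open scoped NNReal in
open Classical in
/-- The indicator function of adjacency. -/
noncomputable def LoopGraph.weight {W : Type*} (H : LoopGraph W) (x y : W) : ℝ≥0 :=
  if H.Adj x y then 1 else 0

theorem LoopGraph.weight_comm {W : Type*} (H : LoopGraph W) (x y : W) :
    H.weight x y = H.weight y x := by
  have h : H.Adj x y ↔ H.Adj y x := ⟨H.symm x y, H.symm y x⟩
  by_cases hxy : H.Adj x y
  · simp [LoopGraph.weight, hxy, h.mp hxy]
  · simp [LoopGraph.weight, hxy, mt h.mpr hxy]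

open scoped NNReal in
open Classical in
/-- The number of homomorphisms from `G` to `H`, where the vertex `v` of `G` has the vertex
weights `lam v` on `H`. -/
noncomputable def weightedHomCount {V W : Type*} [Fintype V] [Fintype W] (G : SimpleGraph V)
    (H : LoopGraph W) (lam : V → W → ℝ≥0) : ℝ≥0 :=
  ∑ φ : V → W, (∏ v, lam v (φ v)) * if LoopGraph.IsHom G H φ then 1 else 0

open Classical in
/-- The neighbours of a vertex, as a finset. -/
noncomputable def nbrs {V : Type*} [Fintype V] (G : SimpleGraph V) (v : V) : Finset V :=
  Finset.univ.filter (G.Adj v)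

theorem mem_nbrs {V : Type*} [Fintype V] {G : SimpleGraph V} {u v : V} :
    u ∈ nbrs G v ↔ G.Adj v u := by
  simp [nbrs]

open scoped NNReal in
/-- The contribution of the ordered edge `(u, v)` to the upper bound. -/
noncomputable def edgeFactor {V W : Type*} [Fintype V] [Fintype W] (G : SimpleGraph V)
    (f : W → W → ℝ≥0) (lam : V → W → ℝ≥0) (u v : V) : ℝ≥0 :=
  bicliqueSum f (nbrs G v).card (nbrs G u).card (lam u) (lam v) ^
    (1 / (2 * ((nbrs G u).card : ℝ) * ((nbrs G v).card : ℝ)))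

open scoped NNReal in
theorem edgeFactor_comm {V W : Type*} [Fintype V] [Fintype W] (G : SimpleGraph V)
    {f : W → W → ℝ≥0} (hf : ∀ x y, f x y = f y x) (lam : V → W → ℝ≥0) (u v : V) :
    edgeFactor G f lam u v = edgeFactor G f lam v u := by
  unfold edgeFactor
  rw [bicliqueSum_comm hf, mul_right_comm]

open scoped NNReal in
/-- The contribution of the vertex `v` to the upper bound. -/
noncomputable def vertexFactor {V W : Type*} [Fintype V] [Fintype W] (G : SimpleGraph V)
    (f : W → W → ℝ≥0) (lam : V → W → ℝ≥0) (v : V) : ℝ≥0 :=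
  (if (nbrs G v).card = 0 then ∑ x, lam v x else 1) * ∏ u ∈ nbrs G v, edgeFactor G f lam u v

open scoped NNReal in
open Classical in
/-- The vertex weights obtained by mapping `w` to `x` and deleting the edges at `w`. -/
noncomputable def pinWeights {V W : Type*} (G : SimpleGraph V) (f : W → W → ℝ≥0)
    (lam : V → W → ℝ≥0) (w : V) (x : W) (v : V) (y : W) : ℝ≥0 :=
  if v = w then (if y = x then lam w x else 0)
  else if G.Adj w v then lam v y * f x y else lam v y

-- Sorts maps by the colour of w. Isolating w instead of removing it keeps the vertex type fixed.
open scoped NNReal in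
theorem weightedHomCount_eq_sum {V W : Type*} [Fintype V] [Fintype W] (G : SimpleGraph V)
    (H : LoopGraph W) (lam : V → W → ℝ≥0) (w : V) :
    weightedHomCount G H lam = ∑ x, weightedHomCount (G.deleteIncidenceSet w) H
      (pinWeights G H.weight lam w x) := by
  classical
  unfold weightedHomCount
  rw [Finset.sum_comm]
  refine Finset.sum_congr rfl fun φ _ => ?_
  rw [Finset.sum_eq_single (φ w)]
  · have h1 : ∏ v, pinWeights G H.weight lam w (φ w) v (φ v) =
        (∏ v, lam v (φ v)) * ∏ v, if G.Adj w v → H.Adj (φ w) (φ v) then 1 else 0 := by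
      rw [← Finset.prod_mul_distrib]
      refine Finset.prod_congr rfl fun v _ => ?_
      unfold pinWeights LoopGraph.weight
      by_cases hv : v = w
      · subst hv; simp
      · by_cases ha : G.Adj w v <;> simp [hv, ha]
    rw [h1, Finset.prod_boole, mul_assoc]
    congr 1
    have h2 : LoopGraph.IsHom G H φ ↔ (∀ v ∈ Finset.univ, G.Adj w v → H.Adj (φ w) (φ v)) ∧
        LoopGraph.IsHom (G.deleteIncidenceSet w) H φ := by
      constructor
      · intro h
        exact ⟨fun v _ => h w v, fun u v huv => h u v (SimpleGraph.deleteIncidenceSet_le G w huv)⟩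
      · rintro ⟨h, h'⟩ u v huv
        by_cases hu : u = w
        · subst hu; exact h v (Finset.mem_univ _) huv
        by_cases hv : v = w
        · subst hv; exact H.symm _ _ (h u (Finset.mem_univ _) huv.symm)
        exact h' u v (SimpleGraph.deleteIncidenceSet_adj.mpr ⟨huv, hu, hv⟩)
    simp only [h2]
    by_cases hA : ∀ v ∈ Finset.univ, G.Adj w v → H.Adj (φ w) (φ v) <;>
      by_cases hB : LoopGraph.IsHom (G.deleteIncidenceSet w) H φ <;> simp only [hA, hB] <;> simp
  · intro x _ hx
    rw [Finset.prod_eq_zero (Finset.mem_univ w), zero_mul]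
    simp [pinWeights, hx.symm]
  · simp

-- Both sides run over the edges leaving N(w) away from w; an edge inside N(w) would close a
-- triangle.
open scoped NNReal in
open Classical in
theorem prod_nbrs_inter_comm {V : Type*} [Fintype V] {G : SimpleGraph V}
    (htri : G.CliqueFree 3) (w : V) (g : V → V → ℝ≥0) :
    ∏ v ∈ Finset.univ \ insert w (nbrs G w), ∏ u ∈ nbrs G v ∩ nbrs G w, g u v =
      ∏ u ∈ nbrs G w, ∏ v ∈ nbrs G u \ {w}, g u v := by
  refine Finset.prod_comm' fun v u => ?_
  simp only [Finset.mem_sdiff, Finset.mem_univ, true_and, Finset.mem_insert, Finset.mem_inter,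
    mem_nbrs, Finset.mem_singleton, not_or]
  constructor
  · rintro ⟨⟨h1, _⟩, h3, h4⟩
    exact ⟨⟨h3.symm, h1⟩, h4⟩
  · rintro ⟨⟨h3, h1⟩, h4⟩
    refine ⟨⟨h1, fun h2 => ?_⟩, h3.symm, h4⟩
    exact htri {w, u, v} (SimpleGraph.is3Clique_triple_iff.mpr ⟨h4, h2, h3⟩)

open scoped NNReal in
open Classical in
/-- Factorisation of the upper bound at a vertex `w` whose neighbourhood is independent. -/
theorem prod_vertexFactor_eq {V W : Type*} [Fintype V] [Fintype W] {G : SimpleGraph V}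
    (htri : G.CliqueFree 3) {f : W → W → ℝ≥0} (hf : ∀ x y, f x y = f y x) (lam : V → W → ℝ≥0)
    {w : V} (hw : (nbrs G w).Nonempty) :
    ∏ v, vertexFactor G f lam v =
      (∏ v ∈ Finset.univ \ insert w (nbrs G w), (if (nbrs G v).card = 0 then ∑ x, lam v x else 1) *
        ∏ u ∈ nbrs G v \ nbrs G w, edgeFactor G f lam u v) *
      ∏ v ∈ nbrs G w, (edgeFactor G f lam w v ^ 2 *
        ∏ u ∈ nbrs G v \ {w}, edgeFactor G f lam u v ^ 2) := by
  have hwN : w ∉ nbrs G w := fun h => (mem_nbrs.mp h).ne rfl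
  have hR : ∀ v, vertexFactor G f lam v = ((if (nbrs G v).card = 0 then ∑ x, lam v x else 1) *
      ∏ u ∈ nbrs G v \ nbrs G w, edgeFactor G f lam u v) *
        ∏ u ∈ nbrs G v ∩ nbrs G w, edgeFactor G f lam u v := by
    intro v
    rw [vertexFactor, mul_assoc, mul_comm (∏ u ∈ nbrs G v \ nbrs G w, _),
      Finset.prod_inter_mul_prod_sdiff]
  have hW : vertexFactor G f lam w = ∏ v ∈ nbrs G w, edgeFactor G f lam w v := by
    rw [vertexFactor, if_neg (Finset.card_pos.mpr hw).ne', one_mul]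
    exact Finset.prod_congr rfl fun v _ => edgeFactor_comm G hf lam v w
  have hN : ∀ v ∈ nbrs G w, vertexFactor G f lam v =
      edgeFactor G f lam w v * ∏ u ∈ nbrs G v \ {w}, edgeFactor G f lam u v := by
    intro v hv
    have hv' : w ∈ nbrs G v := mem_nbrs.mpr (mem_nbrs.mp hv).symm
    rw [vertexFactor, if_neg (Finset.card_pos.mpr ⟨w, hv'⟩).ne', one_mul,
      Finset.sdiff_singleton_eq_erase, Finset.mul_prod_erase _ (fun u => edgeFactor G f lam u v) hv']
  rw [← Finset.prod_sdiff (Finset.subset_univ (insert w (nbrs G w))), Finset.prod_insert hwN,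
    Finset.prod_congr rfl fun v _ => hR v, Finset.prod_mul_distrib, hW,
    Finset.prod_congr rfl hN, prod_nbrs_inter_comm htri, mul_assoc]
  congr 1
  simp only [← Finset.prod_mul_distrib]
  refine Finset.prod_congr rfl fun v _ => ?_
  rw [Finset.prod_pow, Finset.prod_congr rfl fun u _ => edgeFactor_comm G hf lam v u]
  ring

-- The first factor is the one in `prod_vertexFactor_eq` and does not depend on x. For v in N(w),
-- the other neighbours of v lie outside N(w), so they keep their degrees and weights.
open scoped NNReal in
open Classical in
theorem prod_vertexFactor_pin_eq {V W : Type*} [Fintype V] [Fintype W] {G : SimpleGraph V}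
    (htri : G.CliqueFree 3) {f : W → W → ℝ≥0} (hf : ∀ x y, f x y = f y x) (lam : V → W → ℝ≥0)
    (w : V) (x : W) :
    ∏ v, vertexFactor (G.deleteIncidenceSet w) f (pinWeights G f lam w x) v =
      (∏ v ∈ Finset.univ \ insert w (nbrs G w), (if (nbrs G v).card = 0 then ∑ x, lam v x else 1) *
        ∏ u ∈ nbrs G v \ nbrs G w, edgeFactor G f lam u v) *
      (lam w x * ∏ v ∈ nbrs G w,
        ((if (nbrs G v \ {w}).card = 0 then ∑ y, lam v y * f x y else 1) *
          ∏ u ∈ nbrs G v \ {w}, (bicliqueSum f (nbrs G v \ {w}).card (nbrs G u).card (lam u)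
            (fun y => lam v y * f x y) ^
              (1 / (2 * ((nbrs G u).card : ℝ) * ((nbrs G v \ {w}).card : ℝ)))) ^ 2)) := by
  have hwN : w ∉ nbrs G w := fun h => (mem_nbrs.mp h).ne rfl
  set G' := G.deleteIncidenceSet w with hG'
  set lam' := pinWeights G f lam w x with hlam'
  have hadj : ∀ u v, G'.Adj u v ↔ G.Adj u v ∧ u ≠ w ∧ v ≠ w := fun u v =>
    SimpleGraph.deleteIncidenceSet_adj
  have hnw : nbrs G' w = ∅ := by
    ext u; simp [mem_nbrs, hadj]
  have hn : ∀ v, v ≠ w → nbrs G' v = nbrs G v \ {w} := by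
    intro v hv; ext u; simp [mem_nbrs, hadj, hv]
  have hn' : ∀ v, v ≠ w → v ∉ nbrs G w → nbrs G' v = nbrs G v := by
    intro v hv hv'
    rw [hn v hv, Finset.sdiff_singleton_eq_erase, Finset.erase_eq_of_notMem]
    exact fun h => hv' (mem_nbrs.mpr (mem_nbrs.mp h).symm)
  have hl : ∀ v, v ≠ w → v ∉ nbrs G w → lam' v = lam v := by
    intro v hv hv'
    funext y
    simp [hlam', pinWeights, hv, mt mem_nbrs.mpr hv']
  have hl' : ∀ v ∈ nbrs G w, lam' v = fun y => lam v y * f x y := by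
    intro v hv
    funext y
    simp [hlam', pinWeights, (mem_nbrs.mp hv).ne', mem_nbrs.mp hv]
  have hne : ∀ v ∈ nbrs G w, v ≠ w := fun v hv => (mem_nbrs.mp hv).ne'
  have hW : vertexFactor G' f lam' w = lam w x := by
    simp [vertexFactor, hnw, hlam', pinWeights]
  have hRw : ∀ v ∈ Finset.univ \ insert w (nbrs G w), v ≠ w ∧ v ∉ nbrs G w := by
    intro v hv
    simpa [not_or] using hv
  have hR : ∀ v ∈ Finset.univ \ insert w (nbrs G w), vertexFactor G' f lam' v =
      ((if (nbrs G v).card = 0 then ∑ x, lam v x else 1) *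
      ∏ u ∈ nbrs G v \ nbrs G w, edgeFactor G f lam u v) *
        ∏ u ∈ nbrs G v ∩ nbrs G w, edgeFactor G' f lam' u v := by
    intro v hv
    obtain ⟨h1, h2⟩ := hRw v hv
    rw [vertexFactor, hn' v h1 h2, hl v h1 h2,
      ← Finset.prod_inter_mul_prod_sdiff (nbrs G v) (nbrs G w), mul_assoc,
      mul_comm (∏ u ∈ nbrs G v ∩ nbrs G w, _)]
    congr 2
    refine Finset.prod_congr rfl fun u hu => ?_
    obtain ⟨hu1, hu2⟩ := Finset.mem_sdiff.mp hu
    have hu3 : u ≠ w := by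
      rintro rfl
      exact h2 (mem_nbrs.mpr (mem_nbrs.mp hu1).symm)
    rw [edgeFactor, edgeFactor, hn' v h1 h2, hl v h1 h2, hn' u hu3 hu2, hl u hu3 hu2]
  have hE : ∀ v ∈ nbrs G w, ∀ u ∈ nbrs G v \ {w}, edgeFactor G' f lam' u v =
      bicliqueSum f (nbrs G v \ {w}).card (nbrs G u).card (lam u)
        (fun y => lam v y * f x y) ^
          (1 / (2 * ((nbrs G u).card : ℝ) * ((nbrs G v \ {w}).card : ℝ))) := by
    intro v hv u hu
    obtain ⟨hu1, hu2⟩ := Finset.mem_sdiff.mp hu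
    have hu3 : u ≠ w := by simpa using hu2
    have hu4 : u ∉ nbrs G w := fun h => htri {w, v, u}
      (SimpleGraph.is3Clique_triple_iff.mpr ⟨mem_nbrs.mp hv, mem_nbrs.mp h, mem_nbrs.mp hu1⟩)
    rw [edgeFactor, hn v (hne v hv), hl' v hv, hn' u hu3 hu4, hl u hu3 hu4]
  have hN : ∀ v ∈ nbrs G w, vertexFactor G' f lam' v =
      (if (nbrs G v \ {w}).card = 0 then ∑ y, lam v y * f x y else 1) *
        ∏ u ∈ nbrs G v \ {w}, edgeFactor G' f lam' u v := by
    intro v hv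
    rw [vertexFactor, hn v (hne v hv), hl' v hv]
  rw [← Finset.prod_sdiff (Finset.subset_univ (insert w (nbrs G w))), Finset.prod_insert hwN,
    Finset.prod_congr rfl hR, Finset.prod_mul_distrib, hW,
    Finset.prod_congr rfl hN, prod_nbrs_inter_comm htri, mul_assoc]
  congr 1
  rw [mul_left_comm]
  congr 1
  rw [← Finset.prod_mul_distrib]
  refine Finset.prod_congr rfl fun v hv => ?_
  rw [Finset.prod_pow, Finset.prod_congr rfl fun u _ => edgeFactor_comm G' hf lam' v u,
    Finset.prod_congr rfl (hE v hv)]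
  ring

-- After the common factor is removed, Hölder with exponents 1/deg w separates the neighbours of w.
-- Maximality of deg w supplies the condition a ≤ c of the local inequality.
open scoped NNReal in
theorem sum_prod_vertexFactor_pin_le {V W : Type*} [Fintype V] [Fintype W] {G : SimpleGraph V}
    (htri : G.CliqueFree 3) {f : W → W → ℝ≥0} (hf : ∀ x y, f x y = f y x) (lam : V → W → ℝ≥0)
    {w : V} (hw : (nbrs G w).Nonempty) (hmax : ∀ v, (nbrs G v).card ≤ (nbrs G w).card) :
    ∑ x, ∏ v, vertexFactor (G.deleteIncidenceSet w) f (pinWeights G f lam w x) v ≤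
      ∏ v, vertexFactor G f lam v := by
  classical
  rw [prod_vertexFactor_eq htri hf lam hw]
  simp only [prod_vertexFactor_pin_eq htri hf lam w]
  rw [← Finset.mul_sum]
  refine mul_le_mul_right ?_ _
  set c := (nbrs G w).card with hc
  have hc1 : 1 ≤ c := Finset.card_pos.mpr hw
  have hc0 : (c : ℝ) ≠ 0 := by positivity
  set P : V → W → ℝ≥0 := fun v x =>
    (if (nbrs G v \ {w}).card = 0 then ∑ y, lam v y * f x y else 1) *
      ∏ u ∈ nbrs G v \ {w}, (bicliqueSum f (nbrs G v \ {w}).card (nbrs G u).card (lam u)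
        (fun y => lam v y * f x y) ^
          (1 / (2 * ((nbrs G u).card : ℝ) * ((nbrs G v \ {w}).card : ℝ)))) ^ 2 with hP
  have hroot : ∀ z : ℝ≥0, (z ^ c) ^ (1 / (c : ℝ)) = z := by
    intro z
    rw [← NNReal.rpow_natCast, ← NNReal.rpow_mul, mul_one_div_cancel hc0, NNReal.rpow_one]
  have hH := NNReal.sum_mul_prod_rpow_le (lam w) (nbrs G w) (fun v x => P v x ^ c)
    (fun _ => 1 / (c : ℝ)) (by rw [Finset.sum_const, ← hc, nsmul_eq_mul]; field_simp)
    (fun _ _ => by positivity)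
  simp only [hroot] at hH
  refine hH.trans (Finset.prod_le_prod' fun v hv => ?_)
  have hv' : w ∈ nbrs G v := mem_nbrs.mpr (mem_nbrs.mp hv).symm
  have hcard : (nbrs G v).card = (nbrs G v \ {w}).card + 1 := by
    rw [Finset.sdiff_singleton_eq_erase, Finset.card_erase_add_one hv']
  have hmain := sum_mul_prod_bicliqueSum_pow_le hf (nbrs G v \ {w}) (fun u => (nbrs G u).card)
    hc1 (fun u hu => Finset.card_pos.mpr ⟨v, mem_nbrs.mpr
      (mem_nbrs.mp (Finset.mem_sdiff.mp hu).1).symm⟩) (fun u _ => hmax u) (lam w) (lam v) lam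
  refine (NNReal.rpow_le_rpow hmain (by positivity)).trans (le_of_eq ?_)
  rw [hroot]
  simp only [edgeFactor, hcard, ← hc]

/-! ### Induction on the edge set, and the regular case. -/

open scoped NNReal in
/-- The graphical Brascamp-Lieb inequality for a triangle-free graph, for homomorphism counts
with vertex weights. -/
theorem weightedHomCount_le_prod_vertexFactor {V W : Type*} [Fintype V] [Fintype W]
    (H : LoopGraph W) (G : SimpleGraph V) (htri : G.CliqueFree 3) (lam : V → W → ℝ≥0) :
    weightedHomCount G H lam ≤ ∏ v, vertexFactor G H.weight lam v := by
  classical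
  induction G using WellFoundedLT.induction generalizing lam with
  | ind G ih =>
    by_cases hE : ∃ v, (nbrs G v).Nonempty
    · obtain ⟨v₀, hv₀⟩ := hE
      obtain ⟨w, -, hmax⟩ := Finset.exists_max_image Finset.univ (fun v => (nbrs G v).card)
        ⟨v₀, Finset.mem_univ _⟩
      have hw : (nbrs G w).Nonempty := Finset.card_pos.mp
        ((Finset.card_pos.mpr hv₀).trans_le (hmax v₀ (Finset.mem_univ _)))
      rw [weightedHomCount_eq_sum G H lam w]
      have hle : G.deleteIncidenceSet w ≤ G := SimpleGraph.deleteIncidenceSet_le G w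
      have hlt : G.deleteIncidenceSet w < G := by
        refine lt_of_le_of_ne hle fun h => ?_
        obtain ⟨v, hv⟩ := hw
        have h1 := mem_nbrs.mp hv
        rw [← h, SimpleGraph.deleteIncidenceSet_adj] at h1
        exact h1.2.1 rfl
      refine (Finset.sum_le_sum fun x _ => ih _ hlt (htri.anti hle) _).trans ?_
      exact sum_prod_vertexFactor_pin_le htri H.weight_comm lam hw
        fun v => hmax v (Finset.mem_univ _)
    · push Not at hE
      have h1 : ∀ v, vertexFactor G H.weight lam v = ∑ x, lam v x := by
        intro v
        simp [vertexFactor, hE v]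
      simp only [h1]
      rw [Finset.prod_univ_sum, Fintype.piFinset_univ]
      refine Finset.sum_le_sum fun φ _ => ?_
      exact mul_le_of_le_one_right' (by split_ifs <;> simp)

theorem homCount_eq_weightedHomCount {V W : Type*} [Fintype V] [Fintype W] (G : SimpleGraph V)
    (H : LoopGraph W) : (homCount G H : NNReal) = weightedHomCount G H (fun _ _ => 1) := by
  classical
  unfold homCount weightedHomCount
  rw [Nat.card_eq_fintype_card, Fintype.card_subtype]
  simp

theorem homCount_completeBipartiteGraph {W : Type*} [Fintype W] (H : LoopGraph W) (s t : ℕ) :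
    (homCount (completeBipartiteGraph (Fin s) (Fin t)) H : NNReal) =
      bicliqueSum H.weight s t (fun _ => 1) (fun _ => 1) := by
  classical
  rw [homCount_eq_weightedHomCount, bicliqueSum_eq, weightedHomCount]
  trans ∑ p : (Fin s → W) × (Fin t → W),
    if LoopGraph.IsHom (completeBipartiteGraph (Fin s) (Fin t)) H
      ((Equiv.sumArrowEquivProdArrow (Fin s) (Fin t) W).symm p) then (1 : NNReal) else 0
  · refine Finset.sum_equiv (Equiv.sumArrowEquivProdArrow (Fin s) (Fin t) W)
      (fun φ => by simp) fun φ _ => ?_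
    rw [Equiv.symm_apply_apply, Finset.prod_const_one, one_mul]
  rw [Fintype.sum_prod_type]
  refine Finset.sum_congr rfl fun X _ => Finset.sum_congr rfl fun Y _ => ?_
  have h : LoopGraph.IsHom (completeBipartiteGraph (Fin s) (Fin t)) H
      ((Equiv.sumArrowEquivProdArrow (Fin s) (Fin t) W).symm (X, Y)) ↔
      ∀ i ∈ Finset.univ, ∀ j ∈ Finset.univ, H.Adj (X i) (Y j) := by
    constructor
    · intro h i _ j _
      exact h (Sum.inl i) (Sum.inr j) (by simp)
    · rintro h (i | i) (j | j) hij
      · simp at hij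
      · exact h i (Finset.mem_univ _) j (Finset.mem_univ _)
      · exact H.symm _ _ (h j (Finset.mem_univ _) i (Finset.mem_univ _))
      · simp at hij
  by_cases hA : ∀ i ∈ Finset.univ, ∀ j ∈ Finset.univ, H.Adj (X i) (Y j)
  · rw [if_pos (h.mpr hA)]
    simp [LoopGraph.weight, fun i j => hA i (Finset.mem_univ i) j (Finset.mem_univ j)]
  · rw [if_neg (mt h.mp hA)]
    push Not at hA
    obtain ⟨i, hi, j, hj, hij⟩ := hA
    have h0 : ∏ j, H.weight (X i) (Y j) = 0 :=
      Finset.prod_eq_zero hj (by simp [LoopGraph.weight, hij])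
    have h1 : ∏ i, ∏ j, H.weight (X i) (Y j) = 0 := Finset.prod_eq_zero hi h0
    rw [h1, mul_zero]

theorem mainTheorem3 {V W : Type*} [Fintype V] [Nonempty V] [Finite W]
    (G : SimpleGraph V) [DecidableRel G.Adj] (d : ℕ) (hd : 1 ≤ d)
    (hreg : G.IsRegularOfDegree d) (htri : G.CliqueFree 3) (H : LoopGraph W) :
    (homCount G H : ℝ) ^ (1 / (Fintype.card V : ℝ)) ≤
      (homCount (completeBipartiteGraph (Fin d) (Fin d)) H : ℝ) ^ (1 / (2 * (d : ℝ))) := by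
  classical
  have := Fintype.ofFinite W
  have hcard : ∀ v, (nbrs G v).card = d := by
    intro v
    rw [← hreg v, ← SimpleGraph.card_neighborFinset_eq_degree]
    congr 1
    ext u
    simp [mem_nbrs]
  have hd' : (0 : ℝ) < d := by exact_mod_cast hd
  have hn : (0 : ℝ) < Fintype.card V := by exact_mod_cast Fintype.card_pos
  have h := weightedHomCount_le_prod_vertexFactor H G htri (fun _ _ => 1)
  rw [← homCount_eq_weightedHomCount] at h
  have hd0 : d ≠ 0 := by omega
  simp only [vertexFactor, edgeFactor, hcard, hd0, if_false, one_mul, Finset.prod_const,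
    ← homCount_completeBipartiteGraph, Finset.card_univ] at h
  have h2 := NNReal.rpow_le_rpow h (z := 1 / (Fintype.card V : ℝ)) (by positivity)
  -- The exponents multiply to (1/(2d²)) · d · n · (1/n) = 1/(2d), where n = |V|.
  have e : (((((homCount (completeBipartiteGraph (Fin d) (Fin d)) H : NNReal) ^
      (1 / (2 * (d : ℝ) * (d : ℝ)))) ^ d) ^ Fintype.card V) ^ (1 / (Fintype.card V : ℝ))) =
      (homCount (completeBipartiteGraph (Fin d) (Fin d)) H : NNReal) ^ (1 / (2 * (d : ℝ))) := by
    rw [← NNReal.rpow_natCast, ← NNReal.rpow_natCast, ← NNReal.rpow_mul, ← NNReal.rpow_mul,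
      ← NNReal.rpow_mul]
    congr 1
    field_simp
  rw [e] at h2
  exact_mod_cast h2
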